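/- For a finite graded poset $P$ with least element $\hat 0$, greatest element $\hat 1$ and rank function $\rho$, define the integer polynomials $g([\hat 0,a],x)$, $a\in P$, recursively as follows. Put $g([\hat 0,\hat 0],x)=1$. For $a\neq\hat 0$ let $n=\rho(a)-1$, $$f([\hat 0,a],x)=\sum_{\hat 0\le b<a} g([\hat 0,b],x)\,(x-1)^{\,n-\rho(b)}=\sum_{i} h_i x^i,\qquad g([\hat 0,a],x)=\sum_{i=0}^{\lfloor n/2\rfloor}(h_i-h_{i-1})\,x^i,\qquad h_{-1}=0 .$$ The toric $g$-polynomial of a convex polytope is $g([\hat 0,\hat 1],x)$ for its face lattice, that is, the set of all its faces (including the empty face $\hat 0$ and the polytope itself $\hat 1$) ordered by inclusion. The $k$th entry of its toric $g$-vector is the coefficient of $x^k$ in this polynomial. Let $n\ge 0$ and $k\ge 0$ be integers. Then the $k$th entry of the toric $g$-vector of the $n$-dimensional cube $[0,1]^n$ is equal to the number of permutations $\pi$ in the symmetric group $\mathfrak S_n$ on $\{1,\ldots,n\}$ that are $123$-avoiding, that is, there are no $1\le i_1<i_2<i_3\le n$ with $\pi(i_1)<\pi(i_2)<\pi(i_3)$,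 and that have exactly $k$ ascents, that is, exactly $k$ indices $1\le i\le n-1$ with $\pi(i)<\pi(i+1)$. -/

import Mathlib

open Polynomial

/-- The rank `ρ(a)` of an element of a finite poset with least element: the maximal length of a
chain `⊥ < ⋯ < a`. -/
noncomputable def posetRank {α : Type*} [PartialOrder α] (a : α) : ℕ := (Order.height a).toNat

/-- For a polynomial `f = ∑ hᵢ xⁱ`, the polynomial `∑_{0 ≤ i ≤ m} (hᵢ - hᵢ₋₁) xⁱ`, `h₋₁ = 0`. -/
noncomputable def truncatedDifference (m : ℕ) (f : ℤ[X]) : ℤ[X] :=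
  ∑ i ∈ Finset.range (m + 1), monomial i (((1 - X) * f).coeff i)

/-- Stanley's polynomial `g([⊥, a], x)`, by recursion on `a`. It is `1` for `a = ⊥`. Otherwise put
`n = ρ(a) - 1`; then `f([⊥, a], x) = ∑_{b < a} g([⊥, b], x) (x - 1)^(n - ρ(b)) = ∑ hᵢ xⁱ`
and `g([⊥, a], x) = ∑_{0 ≤ i ≤ ⌊n/2⌋} (hᵢ - hᵢ₋₁) xⁱ`. -/
noncomputable def toricGBelow {α : Type*} [PartialOrder α] [OrderBot α] [Finite α] (a : α) :
    ℤ[X] :=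
  open Classical in
  if a = ⊥ then 1
  else truncatedDifference ((posetRank a - 1) / 2)
    (∑ᶠ b : Set.Iio a, toricGBelow b.1 * (X - 1) ^ (posetRank a - 1 - posetRank b.1))
termination_by wellFounded_lt.wrap a
decreasing_by exact b.2

/-- The toric `g`-polynomial of a finite bounded (Eulerian) poset. -/
noncomputable def toricGPolynomial (α : Type*) [PartialOrder α] [BoundedOrder α] [Finite α] :
    ℤ[X] :=
  toricGBelow (⊤ : α)

section Faces

variable {E : Type*} [AddCommGroup E] [Module ℝ E] [TopologicalSpace E]

/-- The faces of a polytope `P`, ordered by inclusion: the empty face, `P` itself, and the sets of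
points of `P` where a linear functional attains its maximum on `P`. -/
abbrev PolytopeFace (P : Set E) : Type _ := {F : Set E // IsExposed ℝ P F}

instance PolytopeFace.instBoundedOrder (P : Set E) : BoundedOrder (PolytopeFace P) where
  bot := ⟨∅, isExposed_empty⟩
  bot_le F := Set.empty_subset F.1
  top := ⟨P, IsExposed.refl P⟩
  le_top F := F.2.subset

end Faces

/-- The `n`-dimensional cube `[0, 1]ⁿ` in `ℝⁿ`. -/
def unitCube (n : ℕ) : Set (Fin n → ℝ) := Set.Icc 0 1

/-- The maximum face of the cube in the direction `l` is cut out by the signs of the coefficients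
of `l`. -/
theorem unitCube_maximizers {n : ℕ} (l : StrongDual ℝ (Fin n → ℝ)) (x : Fin n → ℝ) :
    (x ∈ unitCube n ∧ ∀ y ∈ unitCube n, l y ≤ l x) ↔
      x ∈ unitCube n ∧ ∀ i, (SignType.sign (l (Pi.single i 1)) = 1 → x i = 1) ∧
        (SignType.sign (l (Pi.single i 1)) = -1 → x i = 0) := by
  have hl : ∀ y : Fin n → ℝ, l y = ∑ i, y i * l (Pi.single i 1) := fun y => by
    conv_lhs => rw [pi_eq_sum_univ' y]
    simp [map_sum]
  have upd : ∀ (i : Fin n) (c : ℝ), l (Function.update x i c) - l x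
      = (c - x i) * l (Pi.single i 1) := fun i c => by
    have : Function.update x i c = x + (c - x i) • Pi.single i 1 := by
      ext j
      by_cases h : j = i
      · subst h; simp
      · simp [h]
    rw [this]; simp
  refine and_congr_right fun hx => ⟨fun h i => ⟨fun hs => ?_, fun hs => ?_⟩, fun h y hy => ?_⟩
  · rw [sign_eq_one_iff] at hs
    have := h (Function.update x i 1) ⟨fun j => ?_, fun j => ?_⟩
    · have h1 := upd i 1
      have h2 : x i ≤ 1 := hx.2 i
      nlinarith
    · by_cases hj : j = i
      · subst hj; simp
      · simpa [hj] using hx.1 j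
    · by_cases hj : j = i
      · subst hj; simp
      · simpa [hj] using hx.2 j
  · rw [sign_eq_neg_one_iff] at hs
    have := h (Function.update x i 0) ⟨fun j => ?_, fun j => ?_⟩
    · have h1 := upd i 0
      have h2 : 0 ≤ x i := hx.1 i
      nlinarith
    · by_cases hj : j = i
      · subst hj; simp
      · simpa [hj] using hx.1 j
    · by_cases hj : j = i
      · subst hj; simp
      · simpa [hj] using hx.2 j
  · rw [hl y, hl x]
    refine Finset.sum_le_sum fun i _ => ?_
    have hy1 : y i ≤ 1 := hy.2 i
    have hy0 : 0 ≤ y i := hy.1 i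
    rcases lt_trichotomy (l (Pi.single i 1)) 0 with h0 | h0 | h0
    · rw [(h i).2 (sign_eq_neg_one_iff.2 h0)]; nlinarith
    · simp [h0]
    · rw [(h i).1 (sign_eq_one_iff.2 h0)]; nlinarith

instance unitCube_finite_faces (n : ℕ) : Finite (PolytopeFace (unitCube n)) := by
  let face : Option (Fin n → SignType) → Set (Fin n → ℝ) := fun o => o.elim ∅ fun s =>
    {x | x ∈ unitCube n ∧ ∀ i, (s i = 1 → x i = 1) ∧ (s i = -1 → x i = 0)}
  refine ((Set.finite_range face).subset ?_).to_subtype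
  intro F hF
  rcases F.eq_empty_or_nonempty with rfl | hne
  · exact ⟨none, rfl⟩
  · obtain ⟨l, rfl⟩ := hF hne
    exact ⟨some fun i => SignType.sign (l (Pi.single i 1)),
      Set.ext fun x => (unitCube_maximizers l x).symm⟩

/-- A permutation is `123`-avoiding if no `i₁ < i₂ < i₃` satisfy `π(i₁) < π(i₂) < π(i₃)`. -/
def Avoids123 {n : ℕ} (π : Equiv.Perm (Fin n)) : Prop :=
  ¬ ∃ i₁ i₂ i₃ : Fin n, i₁ < i₂ ∧ i₂ < i₃ ∧ π i₁ < π i₂ ∧ π i₂ < π i₃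

/-- The ascent set of `π`: the positions `i`, not the last one, with `π(i) < π(i + 1)`. -/
def ascentSet {n : ℕ} (π : Equiv.Perm (Fin n)) : Set (Fin n) :=
  {i | ∃ h : i.1 + 1 < n, π i < π ⟨i.1 + 1, h⟩}

open scoped PowerSeries

/-!
Both sides of the theorem have the generating function `G(t)` over `ℤ[x]` that solves
`G = 1 + (t + (x - 1) t²) G²`, namely the Catalan series evaluated at `t + (x - 1) t²`
(`cubeGSeries`).

*Cubes.* The nonempty faces of the `n`-cube correspond to sign vectors, and an `n`-dimensional face
has `n.choose j * 2 ^ (n - j)` faces of dimension `j`. As every proper lower interval is again the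
face lattice of a cube, it suffices that the coefficients `gₙ` of `G` satisfy Stanley's recursion.
Write `y = x - 1` and let
`Φₙ = yⁿ⁺¹ + ∑ⱼ n.choose j * (2y)ⁿ⁻ʲ gⱼ`, so that the recursion's polynomial `fₙ` satisfies
`(1 - x) fₙ = gₙ - Φₙ`. The degree of `gₙ` is at most `n / 2`; what is left to show is that `Φₙ`
has no terms of degree at most `n / 2`. The binomial transform turns the quadratic equation of `G`
into `Φ = x + t (1 - y t) Φ²` for `Φ = ∑ Φₙ tⁿ`, and the divisibility of `Φₙ` by a power of `x`
follows by induction from this equation (`X_pow_dvd_cube_face_sum`).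

*Permutations.* Every permutation arises by prepending first entries, one at a time, to the empty
one. A first entry `a` preserves `123`-avoidance exactly if the values that are at least `a`
appear in decreasing order, that is, if `a` is at least a threshold `c`. Prepending the new maximum
keeps `c` and creates no ascent. Prepending a smaller `a` changes the threshold to `a + 1`, and
creates an ascent exactly if the old permutation starts with its maximum. Hence the number of
continuations depends only on `l = n - c` and on whether the permutation starts with its maximum.
The generating function of continuations is `Gˡ⁺¹`, with a correction in the second case
(`prependSeries_eq`), and starting from the empty permutation one obtains `G` itself
(`sum_avoids123_prependSeries`).
-/

/-! ### The generating function of the cube polynomials -/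

/-- The generating function `G = ∑ₙ g(n-cube) tⁿ` over `ℤ[x]`: the Catalan series
evaluated at `t + (x - 1) t²`. -/
noncomputable def cubeGSeries : ℤ[X]⟦X⟧ :=
  (PowerSeries.catalanSeries.map (Nat.castRingHom ℤ[X])).subst
    (PowerSeries.X + PowerSeries.C (X - 1) * PowerSeries.X ^ 2 : ℤ[X]⟦X⟧)

/-- The quadratic equation that characterizes `cubeGSeries`. -/
theorem cubeGSeries_eq : cubeGSeries =
    1 + (PowerSeries.X + PowerSeries.C (X - 1) * PowerSeries.X ^ 2) * cubeGSeries ^ 2 := by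
  have hs : PowerSeries.HasSubst
      (PowerSeries.X + PowerSeries.C (X - 1) * PowerSeries.X ^ 2 : ℤ[X]⟦X⟧) :=
    PowerSeries.HasSubst.of_constantCoeff_zero' (by simp)
  have h := congrArg (fun c => PowerSeries.substAlgHom (R := ℤ[X]) hs
    (c.map (Nat.castRingHom ℤ[X]))) PowerSeries.catalanSeries_sq_mul_X_add_one
  simp only [map_add, map_mul, map_pow, map_one, PowerSeries.map_X,
    PowerSeries.substAlgHom_X] at h
  rw [PowerSeries.coe_substAlgHom hs] at h
  change cubeGSeries ^ 2 * _ + 1 = cubeGSeries at h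
  linear_combination -h

theorem coeff_zero_cubeGSeries : PowerSeries.coeff 0 cubeGSeries = 1 := by
  rw [cubeGSeries_eq]; simp

theorem natDegree_coeff_cubeGSeries_le (n : ℕ) :
    (PowerSeries.coeff n cubeGSeries).natDegree ≤ n / 2 := by
  induction n using Nat.strong_induction_on with
  | _ n ih =>
    have key : ∀ m, m < n → (PowerSeries.coeff m (cubeGSeries ^ 2)).natDegree ≤ m / 2 := by
      intro m hm
      rw [sq, PowerSeries.coeff_mul]
      refine natDegree_sum_le_of_forall_le _ _ fun p hp => ?_
      have hp' := Finset.HasAntidiagonal.mem_antidiagonal.1 hp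
      have h1 := ih p.1 (by omega)
      have h2 := ih p.2 (by omega)
      exact natDegree_mul_le.trans (by omega)
    have hy : (X - 1 : ℤ[X]).natDegree ≤ 1 := by
      simpa using (natDegree_X_sub_C_le (1 : ℤ))
    have h' : cubeGSeries = 1 + (PowerSeries.X * cubeGSeries ^ 2 +
        PowerSeries.C (X - 1) * (PowerSeries.X * (PowerSeries.X * cubeGSeries ^ 2))) := by
      linear_combination cubeGSeries_eq
    rw [h']
    generalize (X - 1 : ℤ[X]) = y at *
    rcases n with _ | _ | n
    · simp
    · have h0 := key 0 (by omega)
      simp only [map_add, PowerSeries.coeff_succ_X_mul, PowerSeries.coeff_C_mul,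
        PowerSeries.coeff_zero_X_mul, PowerSeries.coeff_one]
      simpa using h0
    · have h0 := key n (by omega)
      have h1 := key (n + 1) (by omega)
      simp only [map_add, PowerSeries.coeff_succ_X_mul, PowerSeries.coeff_C_mul,
        PowerSeries.coeff_one]
      refine (natDegree_add_le _ _).trans (max_le (by simp) ?_)
      refine (natDegree_add_le _ _).trans (max_le (by omega) ?_)
      exact natDegree_mul_le.trans (by omega)

/-- The coefficients of the solution of `Φ = x + t (1 - (x - 1) t) Φ²` vanish to a high order
at `x = 0`. This solution is `∑ₙ xⁿ⁺¹ g(n-cube, 1/x) tⁿ`. -/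
theorem X_pow_dvd_coeff_of_eq {Φ : ℤ[X]⟦X⟧} (h : Φ = PowerSeries.C X +
    PowerSeries.X * (1 - PowerSeries.C (X - 1) * PowerSeries.X) * Φ ^ 2) (n : ℕ) :
    (X : ℤ[X]) ^ ((n + 1) / 2 + 1) ∣ PowerSeries.coeff n Φ := by
  induction n using Nat.strong_induction_on with
  | _ n ih =>
    have key : ∀ m, m < n → (X : ℤ[X]) ^ ((m + 1) / 2 + 2) ∣ PowerSeries.coeff m (Φ ^ 2) := by
      intro m hm
      rw [sq, PowerSeries.coeff_mul]
      refine Finset.dvd_sum fun p hp => ?_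
      have hp' := Finset.HasAntidiagonal.mem_antidiagonal.1 hp
      refine dvd_trans (pow_dvd_pow X ?_)
        ((pow_add (X : ℤ[X]) _ _).dvd.trans (mul_dvd_mul (ih p.1 (by omega)) (ih p.2 (by omega))))
      omega
    have h' : Φ = PowerSeries.C X + (PowerSeries.X * Φ ^ 2 -
        PowerSeries.C (X - 1) * (PowerSeries.X * (PowerSeries.X * Φ ^ 2))) := by
      linear_combination h
    rw [h']
    generalize (X - 1 : ℤ[X]) = y at *
    rcases n with _ | _ | n
    · simp
    · have h0 := key 0 (by omega)
      simp only [map_add, map_sub, PowerSeries.coeff_succ_X_mul, PowerSeries.coeff_C_mul,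
        PowerSeries.coeff_zero_X_mul, PowerSeries.coeff_C]
      simpa using h0
    · have h0 := key n (by omega)
      have h1 := key (n + 1) (by omega)
      simp only [map_add, map_sub, PowerSeries.coeff_succ_X_mul, PowerSeries.coeff_C_mul,
        PowerSeries.coeff_C]
      refine dvd_add (by simp) (dvd_sub ?_ (Dvd.dvd.mul_left ?_ _))
      · exact (pow_dvd_pow X (by omega)).trans h1
      · exact (pow_dvd_pow X (by omega)).trans h0

/-! ### Binomial transforms of power series -/

section BinomialTransform

variable {R : Type*} [CommRing R]

theorem PowerSeries.mk_pow_mul_one_sub (c : R) :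
    PowerSeries.mk (fun n => c ^ n) * (1 - PowerSeries.C c * PowerSeries.X) = 1 := by
  have h := congrArg (PowerSeries.rescale c) (PowerSeries.mk_one_mul_one_sub_eq_one R)
  have h1 : PowerSeries.rescale c (PowerSeries.mk 1) = PowerSeries.mk fun n => c ^ n := by
    ext n; simp
  simpa [h1, PowerSeries.rescale_X] using h

theorem PowerSeries.coeff_X_pow_mul_mk_pow_pow (c : R) (n j : ℕ) :
    PowerSeries.coeff n (PowerSeries.X ^ j * PowerSeries.mk (fun n => c ^ n) ^ (j + 1)) =
      n.choose j * c ^ (n - j) := by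
  have h := congrArg (PowerSeries.rescale c) (PowerSeries.mk_one_pow_eq_mk_choose_add R j)
  have h1 : PowerSeries.rescale c (PowerSeries.mk 1) = PowerSeries.mk fun n => c ^ n := by
    ext n; simp
  rw [map_pow, h1] at h
  rw [PowerSeries.coeff_X_pow_mul', h]
  split_ifs with hj
  · rw [PowerSeries.coeff_rescale, PowerSeries.coeff_mk, Nat.add_sub_cancel' hj, mul_comm]
  · rw [Nat.choose_eq_zero_of_lt (by omega)]; simp

/-- With `u = 1 / (1 - c t)`, the series `u F(t u)` is the generating function of the
binomial transform of the coefficients of `F`. -/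
theorem PowerSeries.coeff_mk_pow_mul_subst (F : R⟦X⟧) (c : R) (n : ℕ) :
    PowerSeries.coeff n (PowerSeries.mk (fun n => c ^ n) *
      F.subst (PowerSeries.X * PowerSeries.mk (fun n => c ^ n) : R⟦X⟧)) =
    ∑ j ∈ Finset.range (n + 1), n.choose j * c ^ (n - j) * PowerSeries.coeff j F := by
  set u : R⟦X⟧ := PowerSeries.mk (fun n => c ^ n) with hu
  have hs : PowerSeries.HasSubst (PowerSeries.X * u : R⟦X⟧) :=
    PowerSeries.HasSubst.of_constantCoeff_zero' (by simp)
  have hco : ∀ m ≤ n, PowerSeries.coeff m (F.subst (PowerSeries.X * u : R⟦X⟧)) =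
      ∑ j ∈ Finset.range (n + 1),
        PowerSeries.coeff j F * PowerSeries.coeff m ((PowerSeries.X * u) ^ j) := by
    intro m hm
    rw [PowerSeries.coeff_subst' hs]
    simp only [smul_eq_mul]
    refine finsum_eq_sum_of_support_subset _ fun j hj => ?_
    by_contra hj'
    simp only [Finset.coe_range, Set.mem_Iio, not_lt] at hj'
    refine hj ?_
    simp only
    rw [mul_pow, PowerSeries.coeff_X_pow_mul', if_neg (by omega), mul_zero]
  rw [PowerSeries.coeff_mul, Finset.sum_congr rfl fun p hp => by
    rw [hco p.2 (by have := Finset.HasAntidiagonal.mem_antidiagonal.1 hp; omega), Finset.mul_sum],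
    Finset.sum_comm]
  refine Finset.sum_congr rfl fun j _ => ?_
  rw [← PowerSeries.coeff_X_pow_mul_mk_pow_pow, ← hu, show PowerSeries.X ^ j * u ^ (j + 1) =
    u * (PowerSeries.X * u) ^ j by ring, PowerSeries.coeff_mul, Finset.sum_mul]
  exact Finset.sum_congr rfl fun p _ => by ring

end BinomialTransform

/-! ### Stanley's recursion for cubes -/

/-- The reciprocity behind Stanley's recursion for cubes: the polynomial
`∑ g(F) (x - 1)^(n + 1 - ρ(F))`, summed over all faces `F` of the `n`-cube, is divisible by a power of
`x` beyond the range in which the `g`-polynomial lives. -/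
theorem X_pow_dvd_cube_face_sum (n : ℕ) : (X : ℤ[X]) ^ ((n + 1) / 2 + 1) ∣
    (X - 1) ^ (n + 1) + ∑ j ∈ Finset.range (n + 1),
      (n.choose j : ℤ[X]) * (2 * (X - 1)) ^ (n - j) * PowerSeries.coeff j cubeGSeries := by
  set y : ℤ[X] := X - 1 with hy
  set u : ℤ[X]⟦X⟧ := PowerSeries.mk (fun n => (2 * y) ^ n) with hu
  set v : ℤ[X]⟦X⟧ := PowerSeries.mk (fun n => y ^ n) with hv
  have hs : PowerSeries.HasSubst (PowerSeries.X * u : ℤ[X]⟦X⟧) :=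
    PowerSeries.HasSubst.of_constantCoeff_zero' (by simp)
  set H : ℤ[X]⟦X⟧ := u * cubeGSeries.subst (PowerSeries.X * u : ℤ[X]⟦X⟧) with hH
  have hu1 : u * (1 - PowerSeries.C (2 * y) * PowerSeries.X) = 1 :=
    PowerSeries.mk_pow_mul_one_sub _
  have hv1 : v * (1 - PowerSeries.C y * PowerSeries.X) = 1 :=
    PowerSeries.mk_pow_mul_one_sub _
  have hC2 : PowerSeries.C (2 * y) = 2 * PowerSeries.C y := by
    rw [two_mul, map_add, two_mul]
  have hCX : (PowerSeries.C X : ℤ[X]⟦X⟧) = PowerSeries.C y + 1 := by simp [hy]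
  have hsub : cubeGSeries.subst (PowerSeries.X * u : ℤ[X]⟦X⟧) =
      1 + (PowerSeries.X * u + PowerSeries.C y * (PowerSeries.X * u) ^ 2) *
        cubeGSeries.subst (PowerSeries.X * u : ℤ[X]⟦X⟧) ^ 2 := by
    have h := congrArg (PowerSeries.substAlgHom (R := ℤ[X]) hs) cubeGSeries_eq
    have hC : PowerSeries.substAlgHom (R := ℤ[X]) hs (PowerSeries.C (X - 1)) =
        PowerSeries.C y := by
      rw [PowerSeries.coe_substAlgHom hs]
      exact PowerSeries.subst_C y
    simp only [map_add, map_mul, map_pow, map_one, PowerSeries.substAlgHom_X, hC] at h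
    rwa [PowerSeries.coe_substAlgHom hs] at h
  -- The equation of `G(t u)` becomes one of `H = u G(t u)` by means of `u (1 - 2 y t) = 1`.
  have hHeq : (1 - 2 * PowerSeries.C y * PowerSeries.X) * H =
      1 + PowerSeries.X * (1 - PowerSeries.C y * PowerSeries.X) * H ^ 2 := by
    rw [hC2] at hu1
    rw [hH]
    set S := cubeGSeries.subst (PowerSeries.X * u : ℤ[X]⟦X⟧)
    linear_combination hsub + S * hu1 - PowerSeries.X * u * S ^ 2 * hu1
  -- `y v` and `H` are the generating functions of the empty and of the nonempty faces.
  have hΦ := X_pow_dvd_coeff_of_eq (Φ := PowerSeries.C y * v + H) (by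
    rw [← hy, hCX]
    linear_combination hHeq + PowerSeries.C y * hv1 - (PowerSeries.X * PowerSeries.C y *
      (PowerSeries.C y * v + 2 * H)) * hv1) n
  have h1 : PowerSeries.coeff n H = _ := PowerSeries.coeff_mk_pow_mul_subst cubeGSeries (2 * y) n
  rwa [map_add, h1, PowerSeries.coeff_C_mul, hv, PowerSeries.coeff_mk, ← pow_succ'] at hΦ

theorem truncatedDifference_eq_of_X_pow_dvd {m : ℕ} {f g : ℤ[X]} (hg : g.natDegree ≤ m)
    (h : X ^ (m + 1) ∣ g - (1 - X) * f) : truncatedDifference m f = g := by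
  rw [truncatedDifference, g.as_sum_range' (m + 1) (by omega)]
  refine Finset.sum_congr rfl fun i hi => ?_
  have h0 := (X_pow_dvd_iff.1 h) i (Finset.mem_range.1 hi)
  rw [coeff_sub, sub_eq_zero] at h0
  rw [h0]

/-- Stanley's recursion for the `n`-cube holds for the coefficients of `cubeGSeries`. The summand
`(X - 1) ^ n` belongs to the empty face, and `n.choose j * 2 ^ (n - j)` counts the faces of
dimension `j`. -/
theorem truncatedDifference_cube_face_sum (n : ℕ) :
    truncatedDifference (n / 2) ((X - 1) ^ n + ∑ j ∈ Finset.range n,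
      (n.choose j * 2 ^ (n - j) : ℕ) •
        (PowerSeries.coeff j cubeGSeries * (X - 1) ^ (n - 1 - j))) =
    PowerSeries.coeff n cubeGSeries := by
  refine truncatedDifference_eq_of_X_pow_dvd (natDegree_coeff_cubeGSeries_le n) ?_
  refine dvd_trans (pow_dvd_pow X (by omega)) ((X_pow_dvd_cube_face_sum n).trans (dvd_of_eq ?_))
  rw [Finset.sum_range_succ]
  have : (X - 1 : ℤ[X]) * ∑ j ∈ Finset.range n, (n.choose j * 2 ^ (n - j) : ℕ) •
        (PowerSeries.coeff j cubeGSeries * (X - 1) ^ (n - 1 - j)) =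
      ∑ j ∈ Finset.range n,
        (n.choose j : ℤ[X]) * (2 * (X - 1)) ^ (n - j) * PowerSeries.coeff j cubeGSeries := by
    rw [Finset.mul_sum]
    refine Finset.sum_congr rfl fun j hj => ?_
    have hj' := Finset.mem_range.1 hj
    rw [nsmul_eq_mul, mul_pow, show n - j = n - 1 - j + 1 by omega, pow_succ (X - 1 : ℤ[X])]
    push_cast
    ring
  rw [← this, Nat.choose_self, Nat.sub_self]
  simp only [pow_succ, pow_zero, Nat.cast_one]
  ring

/-! ### Posets whose lower intervals are face lattices of cubes -/

section CubicalPoset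

variable {α : Type*} [PartialOrder α] [OrderBot α] [Finite α]

/-- A finite poset with a dimension function on its non-bottom elements, in which the lower
intervals have as many elements of each dimension as the face lattice of a cube, is ranked by
dimension plus one. -/
theorem posetRank_eq_of_cube_count (δ : α → ℕ)
    (hmono : ∀ a b : α, a ≠ ⊥ → a < b → δ a < δ b)
    (hcount : ∀ a : α, a ≠ ⊥ → ∀ j,
      Nat.card {b : α // b ≠ ⊥ ∧ b ≤ a ∧ δ b = j} = (δ a).choose j * 2 ^ (δ a - j))
    (a : α) (ha : a ≠ ⊥) : posetRank a = δ a + 1 := by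
  suffices h : Order.height a = (δ a + 1 : ℕ) by rw [posetRank, h, ENat.toNat_natCast]
  induction a using (wellFounded_lt (α := α)).induction with
  | _ a ih =>
    refine le_antisymm (Order.height_le_coe_iff.2 fun b hb => ?_) ?_
    · by_cases hb0 : b = ⊥
      · subst hb0; simp
      · rw [ih b hb hb0]
        have := hmono b a hb0 hb
        exact_mod_cast Nat.succ_lt_succ this
    · rcases Nat.eq_zero_or_pos (δ a) with h0 | h0
      · have := Order.height_add_one_le (bot_lt_iff_ne_bot.2 ha)
        rw [h0]
        simpa using this
      · have hc := hcount a ha (δ a - 1)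
        have hpos : 0 < Nat.card {b : α // b ≠ ⊥ ∧ b ≤ a ∧ δ b = δ a - 1} := by
          rw [hc]
          exact Nat.mul_pos (Nat.choose_pos (Nat.sub_le _ _)) (by positivity)
        obtain ⟨⟨b, hb0, hba, hbd⟩⟩ := (Nat.card_pos_iff.1 hpos).1
        have hlt : b < a := lt_of_le_of_ne hba (by rintro rfl; omega)
        have := Order.height_add_one_le hlt
        rw [ih b hlt hb0, hbd, Nat.sub_add_cancel h0] at this
        exact_mod_cast this

/-- Under the same count of lower intervals, the `g`-polynomials are those of cubes. -/
theorem toricGBelow_eq_of_cube_count (δ : α → ℕ)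
    (hmono : ∀ a b : α, a ≠ ⊥ → a < b → δ a < δ b)
    (hcount : ∀ a : α, a ≠ ⊥ → ∀ j,
      Nat.card {b : α // b ≠ ⊥ ∧ b ≤ a ∧ δ b = j} = (δ a).choose j * 2 ^ (δ a - j))
    (a : α) (ha : a ≠ ⊥) : toricGBelow a = PowerSeries.coeff (δ a) cubeGSeries := by
  classical
  have := Fintype.ofFinite α
  have hrank := posetRank_eq_of_cube_count δ hmono hcount
  have hbot : posetRank (⊥ : α) = 0 := by simp [posetRank]
  induction a using (wellFounded_lt (α := α)).induction with
  | _ a ih =>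
    rw [toricGBelow, if_neg ha, hrank a ha, Nat.add_sub_cancel,
      ← truncatedDifference_cube_face_sum]
    congr 1
    rw [finsum_eq_sum_of_fintype]
    have hS : (Finset.univ.filter fun b : α => b ∈ Set.Iio a) =
        insert ⊥ (Finset.univ.filter fun b : α => b ≠ ⊥ ∧ b < a) := by
      ext b
      by_cases hb : b = ⊥
      · simp [hb, bot_lt_iff_ne_bot.2 ha]
      · simp [hb]
    rw [← Finset.sum_subtype (Finset.univ.filter fun b : α => b ∈ Set.Iio a)
        (p := fun b => b ∈ Set.Iio a) (by simp)
        (fun b => toricGBelow b * (X - 1) ^ (δ a - posetRank b)), hS,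
      Finset.sum_insert (by simp), hbot, Nat.sub_zero]
    congr 1
    · rw [toricGBelow, if_pos rfl, one_mul]
    rw [← Finset.sum_fiberwise_of_maps_to (g := δ) (t := Finset.range (δ a)) fun b hb => by
      rw [Finset.mem_filter] at hb
      exact Finset.mem_range.2 (hmono b a hb.2.1 hb.2.2)]
    refine Finset.sum_congr rfl fun j hj => ?_
    have hj' := Finset.mem_range.1 hj
    rw [Finset.sum_congr rfl (g := fun _ =>
      PowerSeries.coeff j cubeGSeries * (X - 1) ^ (δ a - 1 - j)) fun b hb => by
        simp only [Finset.mem_filter, Finset.mem_univ, true_and] at hb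
        obtain ⟨⟨hb0, hba⟩, rfl⟩ := hb
        rw [ih b hba hb0, hrank b hb0, Nat.sub_sub, Nat.add_comm], Finset.sum_const]
    congr 1
    rw [← hcount a ha j, Nat.card_eq_fintype_card, Fintype.card_subtype, Finset.filter_filter]
    congr 1
    ext b
    simp only [Finset.mem_filter, Finset.mem_univ, true_and, and_assoc]
    refine and_congr_right fun _ => and_congr_left fun hb => ⟨le_of_lt, fun h => ?_⟩
    exact lt_of_le_of_ne h (by rintro rfl; omega)

end CubicalPoset

/-! ### The face lattice of the cube -/

/-- The nonempty face of the cube with sign vector `s`: the coordinates with sign `1` are fixed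
to `1`, those with sign `-1` to `0`, and the others are free. -/
def cubeFace {n : ℕ} (s : Fin n → SignType) : Set (Fin n → ℝ) :=
  {x | x ∈ unitCube n ∧ ∀ i, (s i = 1 → x i = 1) ∧ (s i = -1 → x i = 0)}

/-- The number of free coordinates. -/
def zeroCount {n : ℕ} (s : Fin n → SignType) : ℕ := (Finset.univ.filter fun i => s i = 0).card

theorem isExposed_cubeFace {n : ℕ} (s : Fin n → SignType) :
    IsExposed ℝ (unitCube n) (cubeFace s) := by
  intro _
  let l : StrongDual ℝ (Fin n → ℝ) :=
    ∑ i, (s i : ℝ) • ContinuousLinearMap.proj (R := ℝ) (φ := fun _ : Fin n => ℝ) i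
  refine ⟨l, Set.ext fun x => ?_⟩
  have hl : ∀ i, SignType.sign (l (Pi.single i 1)) = s i := fun i => by
    have : l (Pi.single i 1) = (s i : ℝ) := by
      simp [l, Pi.single_apply]
    rw [this]
    cases s i <;> simp
  have := unitCube_maximizers l x
  simp only [hl] at this
  exact this.symm

theorem exists_cubeFace_eq {n : ℕ} {F : Set (Fin n → ℝ)} (hF : IsExposed ℝ (unitCube n) F)
    (hne : F.Nonempty) : ∃ s, F = cubeFace s := by
  obtain ⟨l, rfl⟩ := hF hne
  exact ⟨fun i => SignType.sign (l (Pi.single i 1)), Set.ext fun x => unitCube_maximizers l x⟩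

theorem cubeFace_subset_iff {n : ℕ} {s t : Fin n → SignType} :
    cubeFace s ⊆ cubeFace t ↔ ∀ i, t i = 0 ∨ t i = s i := by
  refine ⟨fun h i => ?_, fun h x hx => ⟨hx.1, fun i => ?_⟩⟩
  · -- The barycenter of the face has coordinate `1/2` in the free directions.
    let x : Fin n → ℝ := fun i => (1 + (s i : ℝ)) / 2
    have hx : x ∈ cubeFace s := by
      refine ⟨⟨fun i => ?_, fun i => ?_⟩, fun i => ⟨fun hi => ?_, fun hi => ?_⟩⟩
      · show (0 : ℝ) ≤ (1 + (s i : ℝ)) / 2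
        cases s i <;> norm_num
      · show (1 + (s i : ℝ)) / 2 ≤ (1 : ℝ)
        cases s i <;> norm_num
      · show (1 + (s i : ℝ)) / 2 = (1 : ℝ)
        rw [hi]; norm_num
      · show (1 + (s i : ℝ)) / 2 = (0 : ℝ)
        rw [hi]; norm_num
    have h' := (h hx).2 i
    have hxi : x i = (1 + (s i : ℝ)) / 2 := rfl
    rw [hxi] at h'
    revert h'
    cases s i <;> cases t i <;> norm_num
  · rcases h i with h0 | h0 <;> rw [h0]
    · simp
    · exact hx.2 i

theorem cubeFace_nonempty {n : ℕ} (s : Fin n → SignType) : (cubeFace s).Nonempty := by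
  refine ⟨fun i => if s i = 1 then 1 else 0, ⟨fun i => ?_, fun i => ?_⟩, fun i => ?_⟩
  · by_cases h : s i = 1 <;> simp [h]
  · by_cases h : s i = 1 <;> simp [h]
  · by_cases h : s i = 1
    · simp [h]
    · simp [h]

theorem cubeFace_injective {n : ℕ} : Function.Injective (cubeFace (n := n)) := by
  intro s t h
  have h1 := cubeFace_subset_iff.1 h.subset
  have h2 := cubeFace_subset_iff.1 h.symm.subset
  ext i
  rcases h1 i with h0 | h0
  · rcases h2 i with h3 | h3
    · rw [h0, h3]
    · exact h3
  · exact h0.symm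

theorem zeroCount_lt_of_subset {n : ℕ} {s t : Fin n → SignType} (h : cubeFace s ⊆ cubeFace t)
    (hne : s ≠ t) : zeroCount s < zeroCount t := by
  rw [cubeFace_subset_iff] at h
  refine Finset.card_lt_card ⟨fun i hi => ?_, fun hsub => hne ?_⟩
  · simp only [Finset.mem_filter, Finset.mem_univ, true_and] at hi ⊢
    rcases h i with h0 | h0
    · exact h0
    · rw [h0, hi]
  · ext i
    rcases h i with h0 | h0
    · have := hsub (Finset.mem_filter.2 ⟨Finset.mem_univ i, h0⟩)
      rw [h0, (Finset.mem_filter.1 this).2]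
    · exact h0.symm

/-- The faces of a face with `z` free coordinates, counted by dimension, have generating function
`(x + 2)ᶻ`: each free coordinate stays free or is fixed in one of two ways. -/
theorem card_cubeFace_subset {n : ℕ} (t : Fin n → SignType) (j : ℕ) :
    (Finset.univ.filter fun s : Fin n → SignType =>
      (∀ i, t i = 0 ∨ t i = s i) ∧ zeroCount s = j).card =
      (zeroCount t).choose j * 2 ^ (zeroCount t - j) := by
  have h1 : ∑ s : Fin n → SignType with ∀ i, t i = 0 ∨ t i = s i, (X : ℕ[X]) ^ zeroCount s =
      (X + C 2) ^ zeroCount t := by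
    have hfilter : (Finset.univ.filter fun s : Fin n → SignType => ∀ i, t i = 0 ∨ t i = s i) =
        Fintype.piFinset fun i => Finset.univ.filter fun c => t i = 0 ∨ t i = c := by
      ext s; simp
    have hpow : ∀ s : Fin n → SignType,
        (X : ℕ[X]) ^ zeroCount s = ∏ i, if s i = 0 then X else 1 := fun s => by
      rw [Finset.prod_ite]; simp [zeroCount]
    rw [hfilter, Finset.sum_congr rfl fun s _ => hpow s, ← Finset.prod_univ_sum
      (fun i => Finset.univ.filter fun c => t i = 0 ∨ t i = c)
      (fun _ c => if c = 0 then (X : ℕ[X]) else 1)]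
    have hfac : ∀ i, ∑ c : SignType with t i = 0 ∨ t i = c, (if c = 0 then (X : ℕ[X]) else 1) =
        if t i = 0 then X + C 2 else 1 := by
      intro i
      rcases hti : t i with _ | _ | _
      · have : (Finset.univ.filter fun c : SignType =>
          SignType.zero = 0 ∨ SignType.zero = c) = {0, 1, -1} := by decide
        rw [this]
        simp
        norm_num
      · have : (Finset.univ.filter fun c : SignType =>
          SignType.neg = 0 ∨ SignType.neg = c) = {-1} := by decide
        rw [this]; simp
      · have : (Finset.univ.filter fun c : SignType =>
          SignType.pos = 0 ∨ SignType.pos = c) = {1} := by decide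
        rw [this]; simp
    rw [Finset.prod_congr rfl fun i _ => hfac i, Finset.prod_ite]
    simp [zeroCount]
  have h2 := congrArg (fun p => p.coeff j) h1
  simp only [finsetSum_coeff, coeff_X_pow, coeff_X_add_C_pow] at h2
  rw [Finset.sum_boole, Finset.filter_filter] at h2
  simp only [Nat.cast_id] at h2
  rw [mul_comm, ← h2]
  congr 1
  ext s
  simp [eq_comm]

open Classical in
/-- The dimension of a face of the cube; the empty face gets the junk value `0`. -/
noncomputable def cubeFaceDim {n : ℕ} (F : PolytopeFace (unitCube n)) : ℕ :=
  if h : F.1.Nonempty then zeroCount (exists_cubeFace_eq F.2 h).choose else 0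

theorem cubeFaceDim_mk {n : ℕ} (s : Fin n → SignType) :
    cubeFaceDim ⟨cubeFace s, isExposed_cubeFace s⟩ = zeroCount s := by
  have h := cubeFace_nonempty s
  rw [cubeFaceDim, dif_pos h]
  exact congrArg _ (cubeFace_injective
    (exists_cubeFace_eq (isExposed_cubeFace s) h).choose_spec.symm)

theorem exists_eq_cubeFace_of_ne_bot {n : ℕ} {F : PolytopeFace (unitCube n)} (hF : F ≠ ⊥) :
    ∃ s, F = ⟨cubeFace s, isExposed_cubeFace s⟩ := by
  obtain ⟨s, hs⟩ := exists_cubeFace_eq F.2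
    (Set.nonempty_iff_ne_empty.2 fun h => hF (Subtype.ext h))
  exact ⟨s, Subtype.ext hs⟩

theorem cubeFace_ne_bot {n : ℕ} (s : Fin n → SignType) :
    (⟨cubeFace s, isExposed_cubeFace s⟩ : PolytopeFace (unitCube n)) ≠ ⊥ :=
  fun h => (cubeFace_nonempty s).ne_empty (congrArg Subtype.val h)

theorem toricGPolynomial_unitCube (n : ℕ) :
    toricGPolynomial (PolytopeFace (unitCube n)) = PowerSeries.coeff n cubeGSeries := by
  have htop : (⊤ : PolytopeFace (unitCube n)) =
      ⟨cubeFace fun _ => 0, isExposed_cubeFace _⟩ :=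
    Subtype.ext (Set.ext fun x => by
      show x ∈ unitCube n ↔ _
      simp [cubeFace])
  have hdim : cubeFaceDim (⊤ : PolytopeFace (unitCube n)) = n := by
    rw [htop, cubeFaceDim_mk]; simp [zeroCount]
  rw [toricGPolynomial, toricGBelow_eq_of_cube_count cubeFaceDim, hdim]
  · intro F F' hF hlt
    obtain ⟨s, rfl⟩ := exists_eq_cubeFace_of_ne_bot hF
    obtain ⟨t, rfl⟩ := exists_eq_cubeFace_of_ne_bot (bot_le.trans_lt hlt).ne'
    rw [cubeFaceDim_mk, cubeFaceDim_mk]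
    exact zeroCount_lt_of_subset hlt.le (by rintro rfl; exact lt_irrefl _ hlt)
  · intro F hF j
    obtain ⟨t, rfl⟩ := exists_eq_cubeFace_of_ne_bot hF
    rw [cubeFaceDim_mk, ← card_cubeFace_subset, ← Fintype.card_subtype,
      ← Nat.card_eq_fintype_card]
    symm
    refine Nat.card_congr (Equiv.ofBijective (fun s => ⟨⟨cubeFace s.1, isExposed_cubeFace s.1⟩,
      cubeFace_ne_bot s.1, cubeFace_subset_iff.2 s.2.1, ?_⟩) ⟨?_, ?_⟩)
    · rw [cubeFaceDim_mk, s.2.2]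
    · intro s s' h
      simp only [Subtype.mk.injEq] at h
      exact Subtype.ext (cubeFace_injective h)
    · rintro ⟨F, hF0, hle, hd⟩
      obtain ⟨s, rfl⟩ := exists_eq_cubeFace_of_ne_bot hF0
      rw [cubeFaceDim_mk] at hd
      exact ⟨⟨s, cubeFace_subset_iff.1 hle, hd⟩, rfl⟩
  · rw [htop]
    exact cubeFace_ne_bot _

/-! ### Prepending entries to permutations -/

/-- The permutation whose word is `a` followed by the word of `σ`, with the values of `σ` that
are at least `a` shifted up by one. -/
def consPerm {n : ℕ} (a : Fin (n + 1)) (σ : Equiv.Perm (Fin n)) : Equiv.Perm (Fin (n + 1)) :=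
  (finSuccEquiv n).trans ((Equiv.optionCongr σ).trans (finSuccEquiv' a).symm)

@[simp] theorem consPerm_zero {n : ℕ} (a : Fin (n + 1)) (σ : Equiv.Perm (Fin n)) :
    consPerm a σ 0 = a := by
  simp [consPerm]

@[simp] theorem consPerm_succ {n : ℕ} (a : Fin (n + 1)) (σ : Equiv.Perm (Fin n)) (i : Fin n) :
    consPerm a σ i.succ = a.succAbove (σ i) := by
  simp [consPerm]

theorem consPerm_bijective (n : ℕ) : Function.Bijective
    fun p : Fin (n + 1) × Equiv.Perm (Fin n) => consPerm p.1 p.2 := by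
  rw [Fintype.bijective_iff_injective_and_card]
  refine ⟨?_, by simp [Fintype.card_perm, Nat.factorial_succ]⟩
  rintro ⟨a, σ⟩ ⟨b, τ⟩ h
  simp only at h
  obtain rfl : a = b := by simpa using congrArg (fun π => π 0) h
  refine Prod.ext rfl (Equiv.ext fun i => ?_)
  simpa using congrArg (fun π => π i.succ) h

theorem Fin.lt_succAbove_iff_val_le {n : ℕ} (a : Fin (n + 1)) (v : Fin n) :
    a < a.succAbove v ↔ a.1 ≤ v.1 := by
  rw [Fin.lt_succAbove_iff_le_castSucc]; rfl

/-- The values of `σ` that are at least `c` appear in decreasing order. -/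
def DecreasingAbove {n : ℕ} (σ : Equiv.Perm (Fin n)) (c : ℕ) : Prop :=
  ∀ i j : Fin n, i < j → c ≤ (σ i).1 → σ j < σ i

theorem avoids123_consPerm {n : ℕ} (a : Fin (n + 1)) (σ : Equiv.Perm (Fin n)) :
    Avoids123 (consPerm a σ) ↔ Avoids123 σ ∧ DecreasingAbove σ a := by
  refine ⟨fun h => ⟨?_, fun i j hij hi => ?_⟩, ?_⟩
  · rintro ⟨i, j, k, hij, hjk, h1, h2⟩
    exact h ⟨i.succ, j.succ, k.succ, by simpa, by simpa, by simpa, by simpa⟩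
  · by_contra hlt
    have hne : σ i ≠ σ j := fun h' => hij.ne (σ.injective h')
    refine h ⟨0, i.succ, j.succ, Fin.succ_pos i, by simpa, ?_, ?_⟩
    · simpa [Fin.lt_succAbove_iff_val_le] using hi
    · simpa using lt_of_le_of_ne (not_lt.1 hlt) hne
  · rintro ⟨h, ha⟩ ⟨i, j, k, hij, hjk, h1, h2⟩
    obtain ⟨j, rfl⟩ := Fin.exists_succ_eq.2 (Fin.pos_of_ne_zero
      (Fin.ne_zero_of_lt hij)).ne'
    obtain ⟨k, rfl⟩ := Fin.exists_succ_eq.2 (Fin.ne_zero_of_lt hjk)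
    simp only [consPerm_succ, Fin.succAbove_lt_succAbove_iff, Fin.succ_lt_succ_iff] at h2 hjk
    rcases Fin.eq_zero_or_eq_succ i with rfl | ⟨i, rfl⟩
    · rw [consPerm_zero, consPerm_succ, Fin.lt_succAbove_iff_val_le] at h1
      exact lt_asymm h2 (ha j k hjk h1)
    · simp only [consPerm_succ, Fin.succAbove_lt_succAbove_iff, Fin.succ_lt_succ_iff] at h1 hij
      exact h ⟨i, j, k, hij, hjk, h1, h2⟩

/-- The least `c` such that the values of `σ` that are at least `c` appear in decreasing order. -/
noncomputable def decreasingThreshold {n : ℕ} (σ : Equiv.Perm (Fin n)) : ℕ :=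
  sInf {c | DecreasingAbove σ c}

theorem decreasingThreshold_le_iff {n : ℕ} {σ : Equiv.Perm (Fin n)} {c : ℕ} :
    decreasingThreshold σ ≤ c ↔ DecreasingAbove σ c := by
  refine ⟨fun h i j hij hi => ?_, fun h => Nat.sInf_le h⟩
  have hne : {c | DecreasingAbove σ c}.Nonempty :=
    ⟨n, fun i _ _ hi => absurd (σ i).2 (not_lt.2 hi)⟩
  exact Nat.sInf_mem hne i j hij (h.trans hi)

theorem decreasingThreshold_le {n : ℕ} (σ : Equiv.Perm (Fin n)) : decreasingThreshold σ ≤ n :=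
  decreasingThreshold_le_iff.2 fun i _ _ hi => absurd (σ i).2 (not_lt.2 hi)

theorem decreasingThreshold_consPerm_last {n : ℕ} (σ : Equiv.Perm (Fin n)) :
    decreasingThreshold (consPerm (Fin.last n) σ) = decreasingThreshold σ := by
  refine eq_of_forall_ge_iff fun c => ?_
  rw [decreasingThreshold_le_iff, decreasingThreshold_le_iff]
  refine ⟨fun h i j hij hi => ?_, fun h i j hij hi => ?_⟩
  · simpa using h i.succ j.succ (by simpa) (by simpa using hi)
  · obtain ⟨j, rfl⟩ := Fin.exists_succ_eq.2 (Fin.ne_zero_of_lt hij)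
    rcases Fin.eq_zero_or_eq_succ i with rfl | ⟨i, rfl⟩
    · simp [Fin.castSucc_lt_last]
    · simpa using h i j (by simpa using hij) (by simpa using hi)

theorem decreasingThreshold_consPerm_castSucc {n : ℕ} {σ : Equiv.Perm (Fin n)} {v : Fin n}
    (hv : DecreasingAbove σ v) : decreasingThreshold (consPerm v.castSucc σ) = v + 1 := by
  refine eq_of_forall_ge_iff fun c => ?_
  rw [decreasingThreshold_le_iff]
  refine ⟨fun h => ?_, fun h i j hij hi => ?_⟩
  · by_contra! hc
    -- The largest value comes after the new first entry `v`.
    have hpos : 0 < n := v.pos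
    have := h 0 (σ.symm ⟨n - 1, by omega⟩).succ (Fin.succ_pos _) (by simpa using hc)
    rw [consPerm_succ, consPerm_zero, Equiv.apply_symm_apply] at this
    refine lt_asymm this ((Fin.lt_succAbove_iff_val_le _ _).2 ?_)
    simp only [Fin.val_castSucc]
    omega
  · obtain ⟨j, rfl⟩ := Fin.exists_succ_eq.2 (Fin.ne_zero_of_lt hij)
    rcases Fin.eq_zero_or_eq_succ i with rfl | ⟨i, rfl⟩
    · rw [consPerm_zero, Fin.val_castSucc] at hi
      omega
    · rw [consPerm_succ] at hi
      have hlt : v.castSucc < v.castSucc.succAbove (σ i) := by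
        rw [Fin.lt_def, Fin.val_castSucc]; omega
      rw [Fin.lt_succAbove_iff_val_le] at hlt
      simpa using hv i j (by simpa using hij) hlt

/-- The first entry of `σ` is its largest value. -/
def StartsWithMax {n : ℕ} (σ : Equiv.Perm (Fin n)) : Prop :=
  ∃ h : 0 < n, (σ ⟨0, h⟩).1 + 1 = n

theorem startsWithMax_consPerm {n : ℕ} (a : Fin (n + 1)) (σ : Equiv.Perm (Fin n)) :
    StartsWithMax (consPerm a σ) ↔ a = Fin.last n := by
  have : (⟨0, n.succ_pos⟩ : Fin (n + 1)) = 0 := rfl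
  simp [StartsWithMax, this, Fin.ext_iff]

/-- If prepending `v` keeps `σ` `123`-avoiding, it creates an ascent only where `σ` starts with its
maximum: otherwise the first entry of `σ` lies below the maximum that follows it. -/
theorem val_le_apply_zero_iff {n : ℕ} {σ : Equiv.Perm (Fin n)} {v : Fin n}
    (hv : DecreasingAbove σ v) (h0 : 0 < n) : v ≤ σ ⟨0, h0⟩ ↔ StartsWithMax σ := by
  refine ⟨fun h => ⟨h0, ?_⟩, fun ⟨_, h⟩ => by rw [Fin.le_def]; omega⟩
  by_contra hne
  have hlt := (σ ⟨0, h0⟩).2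
  have hi : (σ.symm ⟨n - 1, by omega⟩).1 ≠ 0 := fun h => by
    have h' : σ.symm ⟨n - 1, by omega⟩ = ⟨0, h0⟩ := Fin.ext h
    rw [Equiv.symm_apply_eq] at h'
    rw [← h'] at hne
    simp only at hne
    omega
  have := hv ⟨0, h0⟩ (σ.symm ⟨n - 1, by omega⟩) (Fin.lt_def.2 (Nat.pos_of_ne_zero hi)) h
  rw [Equiv.apply_symm_apply, Fin.lt_def] at this
  simp only at this
  omega

theorem ascentSet_consPerm {n : ℕ} (a : Fin (n + 1)) (σ : Equiv.Perm (Fin n)) :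
    ascentSet (consPerm a σ) =
      Fin.succ '' ascentSet σ ∪ {i | i = 0 ∧ ∃ h : 0 < n, a.1 ≤ (σ ⟨0, h⟩).1} := by
  ext i
  rcases Fin.eq_zero_or_eq_succ i with rfl | ⟨i, rfl⟩
  · simp only [ascentSet, Set.mem_ofPred_eq, Set.mem_union, Set.mem_image, true_and]
    constructor
    · rintro ⟨h, hlt⟩
      have h0 : 0 < n := by simpa using h
      have : (⟨(0 : Fin (n + 1)).1 + 1, h⟩ : Fin (n + 1)) = Fin.succ ⟨0, h0⟩ := Fin.ext (by simp)
      rw [this, consPerm_succ, consPerm_zero, Fin.lt_succAbove_iff_val_le] at hlt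
      exact Or.inr ⟨h0, hlt⟩
    · rintro (⟨j, -, hj⟩ | ⟨h0, hle⟩)
      · exact absurd hj (Fin.succ_ne_zero j)
      · refine ⟨by simpa using h0, ?_⟩
        have : (⟨(0 : Fin (n + 1)).1 + 1, by simpa using h0⟩ : Fin (n + 1)) =
          Fin.succ ⟨0, h0⟩ := Fin.ext (by simp)
        rw [this, consPerm_succ, consPerm_zero, Fin.lt_succAbove_iff_val_le]
        exact hle
  · have h1 : i.succ ∈ Fin.succ '' ascentSet σ ↔ i ∈ ascentSet σ :=
      (Fin.succ_injective n).mem_set_image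
    simp only [Set.mem_union, h1, Set.mem_ofPred_eq, Fin.succ_ne_zero, false_and, or_false]
    simp only [ascentSet, Set.mem_ofPred_eq, consPerm_succ]
    refine ⟨fun ⟨h, hlt⟩ => ⟨by simpa using h, ?_⟩, fun ⟨h, hlt⟩ => ⟨by simpa using h, ?_⟩⟩
    · have : (⟨i.succ.1 + 1, h⟩ : Fin (n + 1)) = Fin.succ ⟨i.1 + 1, by simpa using h⟩ :=
        Fin.ext (by simp)
      rw [this, consPerm_succ] at hlt
      simpa using hlt
    · have : (⟨i.succ.1 + 1, by simpa using h⟩ : Fin (n + 1)) = Fin.succ ⟨i.1 + 1, h⟩ :=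
        Fin.ext (by simp)
      rw [this, consPerm_succ]
      simpa using hlt

theorem ncard_ascentSet_consPerm_last {n : ℕ} (σ : Equiv.Perm (Fin n)) :
    (ascentSet (consPerm (Fin.last n) σ)).ncard = (ascentSet σ).ncard := by
  have : {i : Fin (n + 1) | i = 0 ∧ ∃ h : 0 < n, (Fin.last n).1 ≤ (σ ⟨0, h⟩).1} = ∅ := by
    refine Set.eq_empty_of_forall_notMem fun i => ?_
    rintro ⟨-, h, hle⟩
    exact absurd (σ ⟨0, h⟩).2 (not_lt.2 hle)
  rw [ascentSet_consPerm, this, Set.union_empty,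
    Set.ncard_image_of_injective _ (Fin.succ_injective n)]

open Classical in
theorem ncard_ascentSet_consPerm_castSucc {n : ℕ} {σ : Equiv.Perm (Fin n)} {v : Fin n}
    (hv : DecreasingAbove σ v) : (ascentSet (consPerm v.castSucc σ)).ncard =
      (ascentSet σ).ncard + if StartsWithMax σ then 1 else 0 := by
  have hiff : (∃ h : 0 < n, v.castSucc.1 ≤ (σ ⟨0, h⟩).1) ↔ StartsWithMax σ :=
    ⟨fun ⟨h, hle⟩ => (val_le_apply_zero_iff hv h).1 hle,
      fun h => ⟨v.pos, (val_le_apply_zero_iff hv v.pos).2 h⟩⟩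
  rw [ascentSet_consPerm, ← Set.ncard_image_of_injective (ascentSet σ) (Fin.succ_injective n)]
  by_cases h : StartsWithMax σ
  · have h0 : {i : Fin (n + 1) | i = 0 ∧ ∃ h : 0 < n, v.castSucc.1 ≤ (σ ⟨0, h⟩).1} = {0} := by
      ext i; simp only [hiff, h, and_true]; rfl
    rw [h0, if_pos h, Set.union_singleton, Set.ncard_insert_of_notMem]
    rintro ⟨j, -, hj⟩
    exact Fin.succ_ne_zero j hj
  · have h0 : {i : Fin (n + 1) | i = 0 ∧ ∃ h : 0 < n, v.castSucc.1 ≤ (σ ⟨0, h⟩).1} = ∅ := by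
      ext i; simp only [hiff, h, and_false]; rfl
    rw [h0, if_neg h, Set.union_empty, add_zero]

/-! ### Counting `123`-avoiding permutations by ascents -/

/-- The generating function, by number of prepended entries and new ascents, of the ways to
prepend entries to a `123`-avoiding permutation of `n` with decreasing threshold `n - l`; the
proposition `b` says that this permutation starts with its maximum. -/
noncomputable def prependSeries (l : ℕ) (b : Prop) [Decidable b] : ℤ[X]⟦X⟧ :=
  cubeGSeries ^ (l + 1) + if b then PowerSeries.C (X - 1) *
    (PowerSeries.X * ∑ i ∈ Finset.range l, cubeGSeries ^ (i + 2)) else 0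

theorem prependSeries_congr (l : ℕ) {b b' : Prop} [Decidable b] [Decidable b'] (h : b ↔ b') :
    prependSeries l b = prependSeries l b' := by
  simp only [prependSeries, h]

theorem coeff_zero_prependSeries (l : ℕ) (b : Prop) [Decidable b] :
    PowerSeries.coeff 0 (prependSeries l b) = 1 := by
  have h := coeff_zero_cubeGSeries
  rw [PowerSeries.coeff_zero_eq_constantCoeff] at h
  rw [prependSeries]
  split_ifs <;> simp [h]

/-- One prepended entry: either the new maximum, or one of the `l` smaller admissible values. -/
theorem prependSeries_eq (l : ℕ) (b : Prop) [Decidable b] : prependSeries l b =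
    1 + PowerSeries.X * (prependSeries (l + 1) True +
      PowerSeries.C (if b then X else 1) * ∑ i ∈ Finset.range l, prependSeries (i + 1) False) := by
  -- By the equation of `G`, `(t + y t²) Gⁱ⁺² = Gⁱ⁺¹ - Gⁱ`, and the sum telescopes.
  have htel : ∀ m, PowerSeries.X * (1 + PowerSeries.C (X - 1) * PowerSeries.X) *
      ∑ i ∈ Finset.range m, cubeGSeries ^ (i + 2) = cubeGSeries ^ m - 1 := by
    intro m
    induction m with
    | zero => simp
    | succ m ih =>
      rw [Finset.sum_range_succ, mul_add, ih]
      linear_combination (-cubeGSeries ^ m) * cubeGSeries_eq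
  have h0 := htel (l + 1)
  have hX : (PowerSeries.C X : ℤ[X]⟦X⟧) = PowerSeries.C (X - 1) + 1 := by simp
  simp only [prependSeries, if_true, if_false, add_zero]
  rw [Finset.sum_range_succ] at h0 ⊢
  by_cases hb : b
  · simp only [hb, if_true, hX]
    linear_combination -h0
  · simp only [hb, if_false, map_one]
    linear_combination -h0

open Classical in
/-- Prepending one entry to a permutation, weighted by ascents and by the ways to continue. -/
theorem sum_consPerm_prependSeries {n : ℕ} (σ : Equiv.Perm (Fin n)) (m : ℕ) :
    ∑ a : Fin (n + 1), (if DecreasingAbove σ a then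
      X ^ (ascentSet (consPerm a σ)).ncard * PowerSeries.coeff m (prependSeries
        (n + 1 - decreasingThreshold (consPerm a σ)) (StartsWithMax (consPerm a σ))) else 0) =
    X ^ (ascentSet σ).ncard * PowerSeries.coeff (m + 1)
      (prependSeries (n - decreasingThreshold σ) (StartsWithMax σ)) := by
  have hc := decreasingThreshold_le σ
  rw [Fin.sum_univ_castSucc, prependSeries_eq (n - decreasingThreshold σ), map_add,
    PowerSeries.coeff_succ_X_mul, map_add, PowerSeries.coeff_C_mul, map_sum, add_comm]
  have hT : ∀ l, prependSeries l (StartsWithMax (consPerm (Fin.last n) σ)) =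
      prependSeries l True := fun l =>
    prependSeries_congr l (by simp [startsWithMax_consPerm])
  have hF : ∀ (v : Fin n) l, prependSeries l (StartsWithMax (consPerm v.castSucc σ)) =
      prependSeries l False := fun v l =>
    prependSeries_congr l (by simp [startsWithMax_consPerm, (Fin.castSucc_lt_last v).ne])
  simp only [hT, hF, decreasingThreshold_consPerm_last, ncard_ascentSet_consPerm_last]
  have hlast : DecreasingAbove σ (Fin.last n).1 := decreasingThreshold_le_iff.1 hc
  rw [if_pos hlast, show n + 1 - decreasingThreshold σ = n - decreasingThreshold σ + 1 by omega]
  have hsum : ∑ v : Fin n, (if DecreasingAbove σ v.castSucc.1 then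
      X ^ (ascentSet (consPerm v.castSucc σ)).ncard * PowerSeries.coeff m (prependSeries
        (n + 1 - decreasingThreshold (consPerm v.castSucc σ)) False) else 0) =
      X ^ (ascentSet σ).ncard * ((if StartsWithMax σ then X else 1) *
        ∑ i ∈ Finset.range (n - decreasingThreshold σ),
          PowerSeries.coeff m (prependSeries (i + 1) False)) := by
    have hterm : ∀ v : Fin n, (if DecreasingAbove σ v.castSucc.1 then
        X ^ (ascentSet (consPerm v.castSucc σ)).ncard * PowerSeries.coeff m (prependSeries
          (n + 1 - decreasingThreshold (consPerm v.castSucc σ)) False) else 0) =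
        X ^ (ascentSet σ).ncard * ((if StartsWithMax σ then X else 1) *
          (if decreasingThreshold σ ≤ v.1 then
            PowerSeries.coeff m (prependSeries (n - 1 - v.1 + 1) False) else 0)) := by
      intro v
      have hv := v.2
      by_cases h : DecreasingAbove σ v.1
      · rw [Fin.val_castSucc, if_pos h, if_pos (decreasingThreshold_le_iff.2 h),
          ncard_ascentSet_consPerm_castSucc h, decreasingThreshold_consPerm_castSucc h, pow_add,
          show n + 1 - (v.1 + 1) = n - 1 - v.1 + 1 by omega]
        split_ifs <;> ring
      · rw [Fin.val_castSucc, if_neg h, if_neg (fun h' => h (decreasingThreshold_le_iff.1 h'))]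
        ring
    rw [Finset.sum_congr rfl fun v _ => hterm v, ← Finset.mul_sum, ← Finset.mul_sum,
      Fin.sum_univ_eq_sum_range (fun v => if decreasingThreshold σ ≤ v then
        PowerSeries.coeff m (prependSeries (n - 1 - v + 1) False) else 0),
      ← Finset.sum_range_reflect, ← Finset.sum_filter_of_ne (p := fun v =>
        v < n - decreasingThreshold σ)]
    · congr 2
      refine Finset.sum_congr ?_ fun i hi => ?_
      · ext i; simp only [Finset.mem_filter, Finset.mem_range]; omega
      · have := Finset.mem_range.1 hi
        rw [if_pos (by omega), show n - 1 - (n - 1 - i) = i by omega]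
    · intro i hi hne
      have := Finset.mem_range.1 hi
      by_contra h
      exact hne (if_neg (by omega))
  simp only [hsum, PowerSeries.coeff_one, Nat.succ_ne_zero, if_false, zero_add]
  ring

open Classical in
/-- Counting `123`-avoiding permutations of `n + m` by the permutation formed by the relative order
of their last `n` entries. -/
theorem sum_avoids123_prependSeries (n m : ℕ) :
    ∑ σ : Equiv.Perm (Fin n) with Avoids123 σ, X ^ (ascentSet σ).ncard * PowerSeries.coeff m
      (prependSeries (n - decreasingThreshold σ) (StartsWithMax σ)) =
    PowerSeries.coeff (n + m) cubeGSeries := by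
  induction n generalizing m with
  | zero =>
    have hav : ∀ σ : Equiv.Perm (Fin 0), Avoids123 σ := fun σ ⟨i, _⟩ => i.elim0
    rw [Finset.filter_true_of_mem fun σ _ => hav σ]
    simp [prependSeries, Set.eq_empty_of_isEmpty]
  | succ n ih =>
    rw [Nat.add_right_comm, add_assoc, ← ih, Finset.sum_filter, Finset.sum_filter,
      ← (consPerm_bijective n).sum_comp, Fintype.sum_prod_type, Finset.sum_comm]
    refine Finset.sum_congr rfl fun σ _ => ?_
    by_cases h : Avoids123 σ
    · simp only [avoids123_consPerm, h, true_and, if_true]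
      exact sum_consPerm_prependSeries σ m
    · simp only [avoids123_consPerm, h, false_and, if_false, Finset.sum_const_zero]

theorem mainTheorem11 (n k : ℕ) :
    (toricGPolynomial (PolytopeFace (unitCube n))).coeff k =
      (Nat.card {π : Equiv.Perm (Fin n) // Avoids123 π ∧ (ascentSet π).ncard = k} : ℤ) := by
  classical
  have h := sum_avoids123_prependSeries n 0
  simp only [coeff_zero_prependSeries, mul_one, add_zero] at h
  rw [toricGPolynomial_unitCube, ← h, finsetSum_coeff, Nat.card_eq_fintype_card,
    Fintype.card_subtype, ← Finset.filter_filter]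
  simp only [coeff_X_pow, Finset.sum_boole, eq_comm]
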